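/- Let $\mathcal X$ be a finite set, $Q$ a probability distribution on $\mathcal X$ with mass function $q$ (the prior), $k>2$ an integer, $\tilde t\in\mathbb R^k$, and $T=(T_{[1]},\dots,T_{[k]}):\mathcal X\to\mathbb R^k$ of lattice form, i.e. there are real $b_j,h_j$ with $T_{[j]}(x)\in\{b_j+sh_j : s\in\mathbb N\}$ for all $x\in\mathcal X$ and $1\le j\le k$. Suppose that 1. (Condition 1) there is $\tilde\beta\in\mathbb R^k$ such that the distribution $\tilde P$ on $\mathcal X$ with density $e^{-\tilde\beta^{T}T(x)}/Z(\tilde\beta)$ with respect to $Q$, where $Z(\tilde\beta)=\sum_{x}q(x)e^{-\tilde\beta^{T}T(x)}$, satisfies $E_{\tilde P}[T(X)]=\tilde t$ (this $\tilde P$ is then the maximum entropy distribution relative to $Q$ for the constraint $E[T(X)]=\tilde t$); 2. (Condition 2) the covariance matrix $\Sigma_{ij}=E_{\tilde P}[T_{[i]}T_{[j]}]-E_{\tilde P}[T_{[i]}]E_{\tilde P}[T_{[j]}]$ is invertible. Let $\tilde p$ be the mass function of $\tilde P$, extended to samples by $\tilde p(x_1,\dots,x_n)=\prod_{i=1}^n\tilde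 p(x_i)$, and for $n\ge 1$ let $\mathcal C_n=\{x^{(n)}\in\mathcal X^n : n^{-1}\sum_{i=1}^nT(x_i)=\tilde t\}$. For a probability distribution $P$ on $\mathcal X^\infty$ write $p(x_1,\dots,x_n)=P(X_1=x_1,\dots,X_n=x_n)$. Logarithms are to base 2, with $\log 0=-\infty$, $\log(a/0)=+\infty$ for $a>0$, and $0/0=0$. Then: (a) There exist a probability distribution $P'$ on $\mathcal X^\infty$ and a constant $c>0$ such that, for all large enough $n$ with $\mathcal C_n\ne\emptyset$ and all $x^{(n)}\in\mathcal C_n$, $$\log\frac{p'(x_1,\dots,x_n)}{\tilde p(x_1,\dots,x_n)}>c\log n.$$ (b) There exist a probability distribution $P''$ on $\mathcal X^\infty$ and a constant $c''>0$ such that, for all $n\ge 1$ with $\mathcal C_n\ne\emptyset$ and all $x^{(n)}\in\mathcal C_n$, $$\log\frac{p''(x_1,\dots,x_n)}{\tilde p(x_1,\dots,x_n)}>c''.$$ -/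

import Mathlib

open scoped ENNReal BigOperators

noncomputable section

namespace MaxEnt

variable {𝒳 : Type*} {k : ℕ}

/-- `T` is a lattice random vector: there are real `b_j`, `h_j` such that every value of the
`j`-th coordinate has the form `b_j + s h_j` with `s` a natural number. -/
def IsLattice (T : 𝒳 → Fin k → ℝ) : Prop :=
  ∃ b h : Fin k → ℝ, ∀ j x, ∃ s : ℕ, T x j = b j + (s : ℝ) * h j

/-- The expectation `E_p[f(X)]` under the mass function `p` on a finite sample space. -/
def expect [Fintype 𝒳] (p : 𝒳 → ℝ) (f : 𝒳 → ℝ) : ℝ := ∑ x, p x * f x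

/-- The normalizer `Z(β) = E_Q[exp (-βᵀ T(X))]`. On a finite sample space it is always finite. -/
def partitionFn [Fintype 𝒳] (q : PMF 𝒳) (T : 𝒳 → Fin k → ℝ) (β : Fin k → ℝ) : ℝ :=
  expect (fun x => (q x).toReal) fun x => Real.exp (-(β ⬝ᵥ T x))

/-- The mass function `p̃` of the distribution that has density `exp (-βᵀ T(x)) / Z(β)` with
respect to the prior `Q`. -/
def tiltedMass [Fintype 𝒳] (q : PMF 𝒳) (T : 𝒳 → Fin k → ℝ) (β : Fin k → ℝ) (x : 𝒳) : ℝ :=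
  (q x).toReal * (Real.exp (-(β ⬝ᵥ T x)) / partitionFn q T β)

/-- The moment constraint `E_p[T(X)] = t`. -/
def MomentConstraint [Fintype 𝒳] (p : 𝒳 → ℝ) (T : 𝒳 → Fin k → ℝ) (t : Fin k → ℝ) : Prop :=
  ∀ j, expect p (fun x => T x j) = t j

/-- The `T`-covariance matrix under `p`. -/
def covMatrix [Fintype 𝒳] (p : 𝒳 → ℝ) (T : 𝒳 → Fin k → ℝ) : Matrix (Fin k) (Fin k) ℝ :=
  Matrix.of fun i j => expect p (fun x => T x i * T x j)
    - expect p (fun x => T x i) * expect p (fun x => T x j)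

/-- The set `C_n` of samples of size `n` with `n⁻¹ ∑ T(x_i) = t` (used for `n ≥ 1`). -/
def constraintSet (T : 𝒳 → Fin k → ℝ) (t : Fin k → ℝ) (n : ℕ) : Set (Fin n → 𝒳) :=
  {x | (n : ℝ)⁻¹ • ∑ i, T (x i) = t}

/-- `p(x_1, …, x_n)` for a distribution `P` on the space of infinite sequences. -/
def seqMass [MeasurableSpace 𝒳] (P : MeasureTheory.Measure (ℕ → 𝒳)) {n : ℕ}
    (x : Fin n → 𝒳) : ℝ≥0∞ :=
  P {ω | ∀ i : Fin n, ω i = x i}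

/-- `p(x_1, …, x_n) = ∏ p(x_i)`: the product extension of a mass function on one outcome. -/
def productMass (p : 𝒳 → ℝ) {n : ℕ} (x : Fin n → 𝒳) : ℝ≥0∞ :=
  ENNReal.ofReal (∏ i, p (x i))

/-- The base 2 logarithm with values in `[-∞, ∞]`: `log 0 = -∞` and `log ∞ = ∞`. -/
def log2 (r : ℝ≥0∞) : EReal := ENNReal.log r / ((Real.log 2 : ℝ) : EReal)

end MaxEnt

end

open scoped NNReal

noncomputable section

namespace MaxEnt

/-! ### Binomial estimates -/

/-! Under the i.i.d. law with marginal `tiltedMass`, the sums of `T` form a random walk, and the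
constraint at time `n` says that the walk sits at `n • t`. Invertible covariance makes the support
of `T` span all `k ≥ 3` dimensions, so this event has probability `O(n ^ (-3/2))`
(`exists_measure_constraintEvent_le`). The exponent exceeds 1, and both parts follow from
summability.

For (a), the probabilities stay summable with weights `n ^ (1/4)`. Summing the weighted restrictions
of the law to the constraint events gives a finite measure; after normalization the gain on `C_n` is
of order `n ^ (1/4)`. For (b), Borel–Cantelli makes the walk transient: it ever meets the constraint
with probability below 1, and conditioning on that event gains a constant factor. A uniform i.i.d.
component, added to both measures, makes the inequalities strict and covers samples of tilted mass
zero.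

The local bound `exists_coeff_pow_le` is proved without Fourier analysis. Convolution powers live in
a group algebra; three independent fair coins are split off from `μ ^ 3`, and their sums have atoms
bounded by cubes of normalized binomial coefficients, averaged over the number of coin rounds. -/

theorem centralBinom_sq_mul_le (m : ℕ) : m.centralBinom ^ 2 * (2 * m + 1) ≤ 4 ^ (2 * m) := by
  induction m with
  | zero => simp
  | succ m ih =>
    have h := Nat.succ_mul_centralBinom_succ m
    have h1 : (m + 1) ^ 2 * ((m + 1).centralBinom ^ 2 * (2 * (m + 1) + 1))
        ≤ (m + 1) ^ 2 * 4 ^ (2 * (m + 1)) := by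
      calc (m + 1) ^ 2 * ((m + 1).centralBinom ^ 2 * (2 * (m + 1) + 1))
          = ((m + 1) * (m + 1).centralBinom) ^ 2 * (2 * m + 3) := by ring
        _ = (4 * (2 * m + 1) * (2 * m + 3)) * (m.centralBinom ^ 2 * (2 * m + 1)) := by
            rw [h]; ring
        -- The induction closes because `(2m+1)(2m+3) = 4(m+1)² - 1`.
        _ ≤ (16 * (m + 1) ^ 2) * 4 ^ (2 * m) := by
            refine Nat.mul_le_mul ?_ ih
            nlinarith
        _ = (m + 1) ^ 2 * 4 ^ (2 * (m + 1)) := by ring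
    exact Nat.le_of_mul_le_mul_left h1 (by positivity)

/-- An odd row reduces to the next even one, whose central coefficient is exactly twice the middle
coefficient. -/
theorem choose_sq_mul_le (n l : ℕ) : n.choose l ^ 2 * (n + 1) ≤ 4 ^ n := by
  refine (Nat.mul_le_mul_right _ (Nat.pow_le_pow_left (Nat.choose_le_middle l n) 2)).trans ?_
  rcases Nat.even_or_odd' n with ⟨m, rfl | rfl⟩
  · have := centralBinom_sq_mul_le m
    rw [Nat.centralBinom_eq_two_mul_choose] at this
    simpa using this
  · have h := centralBinom_sq_mul_le (m + 1)
    have h2 : (m + 1).centralBinom = 2 * (2 * m + 1).choose m := by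
      rw [Nat.centralBinom_eq_two_mul_choose, show 2 * (m + 1) = 2 * m + 1 + 1 by ring,
        Nat.choose_succ_succ, Nat.choose_symm_half]
      ring
    have h3 : (2 * m + 1) / 2 = m := by omega
    rw [h2] at h
    rw [h3]
    have h4 : 4 * ((2 * m + 1).choose m ^ 2 * (2 * m + 1 + 1)) ≤ 4 * 4 ^ (2 * m + 1) := by
      calc 4 * ((2 * m + 1).choose m ^ 2 * (2 * m + 1 + 1))
          ≤ (2 * (2 * m + 1).choose m) ^ 2 * (2 * (m + 1) + 1) := by nlinarith [sq_nonneg ((2 * m + 1).choose m)]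
        _ ≤ 4 ^ (2 * (m + 1)) := h
        _ = 4 * 4 ^ (2 * m + 1) := by ring
    omega

/-- The cube of a normalized binomial coefficient, bounded without square roots of `n + 1`. -/
theorem choose_div_two_pow_cube_le (n l : ℕ) {s : ℝ} (hs : 0 < s) :
    ((n.choose l : ℝ) / 2 ^ n) ^ 3 ≤
      (1 / s * (1 / ((n : ℝ) + 1)) + 2 * s * (1 / (((n : ℝ) + 1) * ((n : ℝ) + 2)))) / 2 := by
  set K : ℝ := (n.choose l : ℝ) / 2 ^ n with hK
  have hK0 : 0 ≤ K := by positivity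
  have hK2 : K ^ 2 ≤ 1 / ((n : ℝ) + 1) := by
    have h : ((n.choose l : ℝ)) ^ 2 * ((n : ℝ) + 1) ≤ 4 ^ n := by
      exact_mod_cast choose_sq_mul_le n l
    rw [hK, div_pow, ← pow_mul, mul_comm n 2, pow_mul, div_le_div_iff₀ (by positivity) (by positivity)]
    norm_num
    linarith
  have hK4 : K ^ 4 ≤ 2 * (1 / (((n : ℝ) + 1) * ((n : ℝ) + 2))) := by
    calc K ^ 4 = K ^ 2 * K ^ 2 := by ring
      _ ≤ 1 / ((n : ℝ) + 1) * (1 / ((n : ℝ) + 1)) := by gcongr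
      _ ≤ 2 * (1 / (((n : ℝ) + 1) * ((n : ℝ) + 2))) := by
        rw [div_mul_div_comm, mul_one_div, div_le_div_iff₀ (by positivity) (by positivity)]
        nlinarith [(n.cast_nonneg : (0 : ℝ) ≤ n)]
  -- AM–GM with a free parameter trades the odd power of `K` for even ones, whose bounds have simple
  -- binomial averages.
  have hK1 : K ≤ (1 / s + s * K ^ 2) / 2 := by
    have : 1 / s + s * K ^ 2 - 2 * K = (1 - s * K) ^ 2 / s := by field_simp; ring
    have h2 : 0 ≤ (1 - s * K) ^ 2 / s := by positivity
    linarith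
  calc K ^ 3 = K * K ^ 2 := by ring
    _ ≤ (1 / s + s * K ^ 2) / 2 * K ^ 2 := by gcongr
    _ = (1 / s * K ^ 2 + s * K ^ 4) / 2 := by ring
    _ ≤ _ := by
      have := mul_le_mul_of_nonneg_left hK2 (one_div_pos.2 hs).le
      have := mul_le_mul_of_nonneg_left hK4 hs.le
      linarith

/-- Absorbing `1/(j+1)` into the binomial coefficient gives the expansion of `(a + b) ^ (m + 1)`
without its zeroth term. -/
theorem sum_binomial_div_succ_le {a b : ℝ} (ha : 0 < a) (hb : 0 ≤ b) (hab : a + b = 1) (m : ℕ) :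
    ∑ j ∈ Finset.range (m + 1), a ^ j * b ^ (m - j) * (m.choose j) * (1 / ((j : ℝ) + 1))
      ≤ 1 / (a * (m + 1)) := by
  have key : ∀ j : ℕ, (m.choose j : ℝ) * (1 / ((j : ℝ) + 1))
      = ((m + 1).choose (j + 1) : ℝ) / (m + 1) := by
    intro j
    have h : ((m : ℝ) + 1) * m.choose j = (m + 1).choose (j + 1) * (j + 1) := by
      exact_mod_cast Nat.add_one_mul_choose_eq m j
    field_simp
    linarith
  have h1 : ∑ j ∈ Finset.range (m + 1), a ^ j * b ^ (m - j) * (m.choose j) * (1 / ((j : ℝ) + 1))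
      = 1 / (a * (m + 1)) * ∑ j ∈ Finset.range (m + 1),
        a ^ (j + 1) * b ^ (m + 1 - (j + 1)) * ((m + 1).choose (j + 1) : ℝ) := by
    rw [Finset.mul_sum]
    refine Finset.sum_congr rfl fun j _ => ?_
    rw [mul_assoc, key, Nat.add_sub_add_right]
    field_simp
    ring
  rw [h1]
  refine mul_le_of_le_one_right (by positivity) ?_
  have h2 := add_pow a b (m + 1)
  rw [hab, one_pow, Finset.sum_range_succ'] at h2
  rw [h2]
  exact le_add_of_nonneg_right (by positivity)

theorem sum_binomial_div_succ_mul_succ_le {a b : ℝ} (ha : 0 < a) (hb : 0 ≤ b) (hab : a + b = 1)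
    (m : ℕ) :
    ∑ j ∈ Finset.range (m + 1),
        a ^ j * b ^ (m - j) * (m.choose j) * (1 / (((j : ℝ) + 1) * ((j : ℝ) + 2)))
      ≤ 1 / (a * (m + 1)) ^ 2 := by
  have key : ∀ j : ℕ, (m.choose j : ℝ) * (1 / (((j : ℝ) + 1) * ((j : ℝ) + 2)))
      = ((m + 1).choose (j + 1) : ℝ) * (1 / (((j + 1 : ℕ) : ℝ) + 1)) / (m + 1) := by
    intro j
    have h : ((m : ℝ) + 1) * m.choose j = (m + 1).choose (j + 1) * (j + 1) := by
      exact_mod_cast Nat.add_one_mul_choose_eq m j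
    push_cast
    field_simp
    linear_combination (j + 1 + 1 : ℝ) * h
  have h1 : ∑ j ∈ Finset.range (m + 1),
        a ^ j * b ^ (m - j) * (m.choose j) * (1 / (((j : ℝ) + 1) * ((j : ℝ) + 2)))
      = 1 / (a * (m + 1)) * ∑ j ∈ Finset.range (m + 1),
        a ^ (j + 1) * b ^ (m + 1 - (j + 1)) * ((m + 1).choose (j + 1) : ℝ)
          * (1 / (((j + 1 : ℕ) : ℝ) + 1)) := by
    rw [Finset.mul_sum]
    refine Finset.sum_congr rfl fun j _ => ?_
    rw [mul_assoc, key, Nat.add_sub_add_right]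
    field_simp
    ring
  have e : 1 / (a * ((m : ℝ) + 1)) ^ 2 = 1 / (a * (m + 1)) * (1 / (a * (m + 1))) := by
    rw [sq, one_div_mul_one_div]
  rw [h1, e]
  refine mul_le_mul_of_nonneg_left ?_ (by positivity)
  have h2 := sum_binomial_div_succ_le ha hb hab (m + 1)
  rw [Finset.sum_range_succ'] at h2
  have h3 : 1 / (a * (((m + 1 : ℕ) : ℝ) + 1)) ≤ 1 / (a * (m + 1)) := by
    push_cast
    gcongr
    linarith
  refine (le_add_of_nonneg_right ?_).trans (h2.trans h3)
  positivity

/-! ### Concentration of powers in a group algebra -/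

section GroupAlgebra

variable {V : Type*} [AddCommGroup V]

/-- The total mass of an element of the group algebra, as an algebra homomorphism. -/
def totalMass (V : Type*) [AddCommGroup V] : AddMonoidAlgebra ℝ≥0 V →ₐ[ℝ≥0] ℝ≥0 :=
  AddMonoidAlgebra.lift ℝ≥0 ℝ≥0 V 1

theorem totalMass_single (v : V) (r : ℝ≥0) : totalMass V (AddMonoidAlgebra.single v r) = r := by
  simp [totalMass]

/-- Convolving with a point mass only translates and scales the coefficients; the general case is
linear in `g`. -/
theorem coeff_mul_le {f : AddMonoidAlgebra ℝ≥0 V} {M : ℝ≥0} (hf : ∀ v, f.coeff v ≤ M)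
    (g : AddMonoidAlgebra ℝ≥0 V) (v : V) : (f * g).coeff v ≤ M * totalMass V g := by
  induction g using AddMonoidAlgebra.induction_linear with
  | zero => simp
  | add g h hg hh =>
    rw [mul_add, map_add, mul_add, AddMonoidAlgebra.coeff_add, Finsupp.add_apply]
    exact add_le_add hg hh
  | single w r =>
    rw [AddMonoidAlgebra.coeff_mul_single_apply, totalMass_single]
    gcongr
    exact hf _

end GroupAlgebra

section Concentration

variable {V : Type*} [AddCommGroup V]

/-- Splits a fair coin flip between two atoms off `μ`, leaving a nonnegative remainder. -/
theorem exists_eq_smul_add {μ : AddMonoidAlgebra ℝ≥0 V} {v w : V} (hvw : v ≠ w) {γ : ℝ≥0}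
    (hv : γ ≤ μ.coeff v) (hw : γ ≤ μ.coeff w) :
    ∃ ν, μ = γ • (AddMonoidAlgebra.single v (1 : ℝ≥0) + AddMonoidAlgebra.single w 1) + ν := by
  classical
  have h : Finsupp.single v γ + Finsupp.single w γ ≤ μ.coeff := by
    intro u
    rw [Finsupp.add_apply, Finsupp.single_apply, Finsupp.single_apply]
    split_ifs with h1 h2 h2
    · exact absurd (h1.trans h2.symm) hvw
    · simpa [← h1] using hv
    · simpa [← h2] using hw
    · simp
  obtain ⟨ν, hν⟩ := le_iff_exists_add.1 h
  refine ⟨AddMonoidAlgebra.ofCoeff ν, ?_⟩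
  rw [← AddMonoidAlgebra.coeff_inj, hν]
  simp [smul_add]

/-- If `μ ^ 3` dominates a multiple of the law of a uniform vertex of a parallelepiped, the
coefficients of its powers are bounded by an average of cubes of binomial coefficients. -/
theorem coeff_pow_le_sum {f P ν : AddMonoidAlgebra ℝ≥0 V} {γ : ℝ≥0} (hf : f = γ • P + ν)
    {M : ℕ → ℝ≥0} (hP : ∀ j v, (P ^ j).coeff v ≤ M j) (m : ℕ) (v : V) :
    (f ^ m).coeff v ≤ ∑ j ∈ Finset.range (m + 1),
      γ ^ j * totalMass V ν ^ (m - j) * m.choose j * M j := by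
  rw [hf, add_pow, AddMonoidAlgebra.coeff_sum, Finsupp.finsetSum_apply]
  refine Finset.sum_le_sum fun j _ => ?_
  rw [smul_pow, smul_mul_assoc, smul_mul_assoc, AddMonoidAlgebra.coeff_smul_apply, smul_eq_mul,
    mul_assoc (P ^ j)]
  have h := coeff_mul_le (hP j) (ν ^ (m - j) * (m.choose j : AddMonoidAlgebra ℝ≥0 V)) v
  rw [map_mul, map_pow, map_natCast] at h
  calc γ ^ j * (P ^ j * (ν ^ (m - j) * (m.choose j : AddMonoidAlgebra ℝ≥0 V))).coeff v
      ≤ γ ^ j * (M j * (totalMass V ν ^ (m - j) * m.choose j)) := by gcongr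
    _ = γ ^ j * totalMass V ν ^ (m - j) * m.choose j * M j := by ring

variable [Module ℝ V]

/-- `l i` counts how often coin `i` shows `a₀` in `j` rounds. Linear independence recovers every
count from the final position. -/
theorem injOn_sum_nsmul {ι : Type*} [Fintype ι] [DecidableEq ι] {a₀ : V} {a : ι → V}
    (ha : LinearIndependent ℝ fun i => a i - a₀) (j : ℕ) :
    Set.InjOn (fun l : ι → ℕ => ∑ i, (l i • a₀ + (j - l i) • a i))
      (Fintype.piFinset fun _ : ι => Finset.range (j + 1)) := by
  intro l hl l' hl' h
  simp only [Finset.mem_coe, Fintype.mem_piFinset, Finset.mem_range] at hl hl'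
  have key : ∀ l : ι → ℕ, (∀ i, l i < j + 1) → ∑ i, (l i • a₀ + (j - l i) • a i)
      = ∑ _i : ι, (j : ℝ) • a₀ + ∑ i, ((j : ℝ) - l i) • (a i - a₀) := by
    intro l hl
    rw [← Finset.sum_add_distrib]
    refine Finset.sum_congr rfl fun i _ => ?_
    rw [← Nat.cast_smul_eq_nsmul ℝ (l i), ← Nat.cast_smul_eq_nsmul ℝ (j - l i),
      Nat.cast_sub (Nat.lt_succ_iff.1 (hl i))]
    module
  simp only [key l hl, key l' hl', add_right_inj] at h
  have h0 : ∑ i, ((l' i : ℝ) - l i) • (a i - a₀) = 0 := by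
    rw [← sub_eq_zero, ← Finset.sum_sub_distrib] at h
    rw [← h]
    refine Finset.sum_congr rfl fun i _ => ?_
    module
  have h1 := Fintype.linearIndependent_iff.1 ha _ h0
  funext i
  have := h1 i
  rw [sub_eq_zero] at this
  exact_mod_cast this.symm

/-- By injectivity at most one vector of counts reaches `v`, so the coefficient is at most a single
product of binomials. -/
theorem coeff_prod_pair_pow_le {ι : Type*} [Fintype ι] {a₀ : V} {a : ι → V}
    (ha : LinearIndependent ℝ fun i => a i - a₀) (j : ℕ) (v : V) :
    ((∏ i, (AddMonoidAlgebra.single a₀ (1 : ℝ≥0) + AddMonoidAlgebra.single (a i) 1)) ^ j).coeff v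
      ≤ (j.choose (j / 2) : ℝ≥0) ^ Fintype.card ι := by
  classical
  have h1 : (∏ i, (AddMonoidAlgebra.single a₀ (1 : ℝ≥0) + AddMonoidAlgebra.single (a i) 1)) ^ j
      = ∑ l ∈ Fintype.piFinset fun _ : ι => Finset.range (j + 1),
          AddMonoidAlgebra.single (∑ i, (l i • a₀ + (j - l i) • a i))
            (∏ i, (j.choose (l i) : ℝ≥0)) := by
    rw [← Finset.prod_pow]
    have : ∀ i, (AddMonoidAlgebra.single a₀ (1 : ℝ≥0) + AddMonoidAlgebra.single (a i) 1) ^ j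
        = ∑ l ∈ Finset.range (j + 1), AddMonoidAlgebra.single (l • a₀ + (j - l) • a i)
            (j.choose l : ℝ≥0) := by
      intro i
      rw [add_pow]
      refine Finset.sum_congr rfl fun l _ => ?_
      rw [AddMonoidAlgebra.single_pow, AddMonoidAlgebra.single_pow,
        AddMonoidAlgebra.single_mul_single, AddMonoidAlgebra.natCast_def,
        AddMonoidAlgebra.single_mul_single]
      simp
    simp_rw [this]
    rw [Finset.prod_univ_sum]
    refine Finset.sum_congr rfl fun l _ => ?_
    rw [AddMonoidAlgebra.prod_single]
  rw [h1, AddMonoidAlgebra.coeff_sum, Finsupp.finsetSum_apply]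
  simp only [AddMonoidAlgebra.coeff_single, Finsupp.single_apply]
  rw [← Finset.sum_filter]
  refine (Finset.sum_le_card_nsmul _ _ ((j.choose (j / 2) : ℝ≥0) ^ Fintype.card ι) ?_).trans ?_
  · intro l _
    rw [Fintype.card, ← Finset.prod_const]
    refine Finset.prod_le_prod' fun i _ => ?_
    exact_mod_cast Nat.choose_le_middle _ _
  · rw [nsmul_eq_mul]
    refine mul_le_of_le_one_left zero_le ?_
    have : (Finset.filter (fun l : ι → ℕ => ∑ i, (l i • a₀ + (j - l i) • a i) = v)
        (Fintype.piFinset fun _ : ι => Finset.range (j + 1))).card ≤ 1 := by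
      rw [Finset.card_le_one]
      intro l hl l' hl'
      rw [Finset.mem_filter] at hl hl'
      exact injOn_sum_nsmul ha j hl.1 hl'.1 (hl.2.trans hl'.2.symm)
    exact_mod_cast this

/-- Concentration bound: the `n`-th convolution power of a probability charging the vertices of a
three-dimensional simplex has atoms of size `O(n ^ (-3/2))`. -/
theorem exists_coeff_pow_le {μ : AddMonoidAlgebra ℝ≥0 V} (hμ : totalMass V μ = 1)
    {a₀ : V} {a : Fin 3 → V} (ha : LinearIndependent ℝ fun i => a i - a₀)
    (h₀ : 0 < μ.coeff a₀) (h : ∀ i, 0 < μ.coeff (a i)) :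
    ∃ C : ℝ, 0 < C ∧ ∀ (n : ℕ) (v : V),
      ((μ ^ n).coeff v : ℝ) ≤ C * ((n : ℝ) + 1) ^ (-(3 / 2) : ℝ) := by
  obtain ⟨γ, hγ, hγ₀, hγa⟩ : ∃ γ : ℝ≥0, 0 < γ ∧ γ ≤ μ.coeff a₀ ∧ ∀ i, γ ≤ μ.coeff (a i) := by
    refine ⟨min (μ.coeff a₀) (Finset.univ.inf' Finset.univ_nonempty fun i => μ.coeff (a i)), ?_,
      min_le_left _ _, fun i => (min_le_right _ _).trans (Finset.inf'_le _ (Finset.mem_univ i))⟩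
    rw [lt_min_iff, Finset.lt_inf'_iff]
    exact ⟨h₀, fun i _ => h i⟩
  have hne : ∀ i, a₀ ≠ a i := fun i e => ha.ne_zero i (by simp [← e])
  choose ν hν using fun i => exists_eq_smul_add (hne i) hγ₀ (hγa i)
  set s : Fin 3 → AddMonoidAlgebra ℝ≥0 V := fun i =>
    AddMonoidAlgebra.single a₀ (1 : ℝ≥0) + AddMonoidAlgebra.single (a i) 1 with hs
  -- Each of the three factors `μ` is split along a different edge of the simplex; all other terms
  -- go into `ρ`.
  obtain ⟨ρ, hρ⟩ : ∃ ρ, μ ^ 3 = γ ^ 3 • ∏ i, s i + ρ := by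
    refine ⟨(γ • s 0 * (γ • s 1) * ν 2 + γ • s 0 * ν 1 * μ + ν 0 * μ ^ 2), ?_⟩
    have e : μ ^ 3 = γ • s 0 * (γ • s 1) * (γ • s 2)
        + (γ • s 0 * (γ • s 1) * ν 2 + γ • s 0 * ν 1 * μ + ν 0 * μ ^ 2) := by
      calc μ ^ 3 = μ * μ ^ 2 := by ring
        _ = (γ • s 0 + ν 0) * μ ^ 2 := by rw [← hν 0]
        _ = γ • s 0 * (μ * μ) + ν 0 * μ ^ 2 := by ring
        _ = γ • s 0 * ((γ • s 1 + ν 1) * μ) + ν 0 * μ ^ 2 := by rw [← hν 1]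
        _ = γ • s 0 * (γ • s 1) * μ + γ • s 0 * ν 1 * μ + ν 0 * μ ^ 2 := by ring
        _ = γ • s 0 * (γ • s 1) * (γ • s 2 + ν 2) + γ • s 0 * ν 1 * μ + ν 0 * μ ^ 2 := by
            rw [← hν 2]
        _ = _ := by ring
    rw [e, Fin.prod_univ_three]
    congr 1
    rw [smul_mul_smul_comm, smul_mul_smul_comm, pow_three, mul_assoc]
  -- The product of the three coins has mass 8, so `α` and `b` below are the weights of a binomial
  -- law.
  have hmass : 8 * γ ^ 3 + totalMass V ρ = 1 := by
    have := congrArg (totalMass V) hρ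
    rw [map_pow, hμ, one_pow, map_add, map_smul, map_prod] at this
    rw [this]
    congr 1
    simp only [hs, map_add, totalMass_single, Finset.prod_const, Finset.card_univ,
      Fintype.card_fin, smul_eq_mul]
    norm_num
    ring
  set α : ℝ := 8 * (γ : ℝ) ^ 3 with hα
  set b : ℝ := (totalMass V ρ : ℝ) with hb
  have hα0 : 0 < α := by positivity
  have hb0 : 0 ≤ b := NNReal.coe_nonneg _
  have hαb : α + b = 1 := by
    rw [hα, hb]
    exact_mod_cast hmass
  have hcube : ∀ (m : ℕ) (v : V), (((μ ^ 3) ^ m).coeff v : ℝ)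
      ≤ (1 / α + 2 / α ^ 2) / 2 * ((m : ℝ) + 1) ^ (-(3 / 2) : ℝ) := by
    intro m v
    have h1 := coeff_pow_le_sum hρ (fun j v => coeff_prod_pair_pow_le ha j v) m v
    rw [← NNReal.coe_le_coe] at h1
    refine h1.trans ?_
    push_cast
    have hm : (0 : ℝ) < (m : ℝ) + 1 := by positivity
    -- This AM–GM parameter makes both averaged terms of order `t ^ (-3)`.
    set t : ℝ := √((m : ℝ) + 1) with ht
    have ht0 : 0 < t := Real.sqrt_pos.2 hm
    have htt : (m : ℝ) + 1 = t ^ 2 := (Real.sq_sqrt hm.le).symm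
    calc ∑ j ∈ Finset.range (m + 1), ((γ : ℝ) ^ 3) ^ j * b ^ (m - j) * (m.choose j : ℝ)
          * (j.choose (j / 2) : ℝ) ^ Fintype.card (Fin 3)
        = ∑ j ∈ Finset.range (m + 1), α ^ j * b ^ (m - j) * (m.choose j : ℝ)
          * ((j.choose (j / 2) : ℝ) / 2 ^ j) ^ 3 := by
          refine Finset.sum_congr rfl fun j _ => ?_
          have e : α ^ j = (2 ^ j) ^ 3 * ((γ : ℝ) ^ 3) ^ j := by
            rw [hα, mul_pow, ← pow_mul 2 j 3, mul_comm j 3, pow_mul 2 3 j]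
            norm_num
          rw [e, Fintype.card_fin]
          field_simp
      _ ≤ ∑ j ∈ Finset.range (m + 1), α ^ j * b ^ (m - j) * (m.choose j : ℝ)
          * ((1 / t * (1 / ((j : ℝ) + 1)) + 2 * t * (1 / (((j : ℝ) + 1) * ((j : ℝ) + 2)))) / 2) := by
          refine Finset.sum_le_sum fun j _ => ?_
          exact mul_le_mul_of_nonneg_left (choose_div_two_pow_cube_le j (j / 2) ht0)
            (by positivity)
      _ = 1 / (2 * t) * ∑ j ∈ Finset.range (m + 1),
            α ^ j * b ^ (m - j) * (m.choose j) * (1 / ((j : ℝ) + 1))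
          + t * ∑ j ∈ Finset.range (m + 1),
            α ^ j * b ^ (m - j) * (m.choose j) * (1 / (((j : ℝ) + 1) * ((j : ℝ) + 2))) := by
          rw [Finset.mul_sum, Finset.mul_sum, ← Finset.sum_add_distrib]
          refine Finset.sum_congr rfl fun j _ => ?_
          field_simp
      _ ≤ 1 / (2 * t) * (1 / (α * (m + 1))) + t * (1 / (α * (m + 1)) ^ 2) := by
          gcongr
          · exact sum_binomial_div_succ_le hα0 hb0 hαb m
          · exact sum_binomial_div_succ_mul_succ_le hα0 hb0 hαb m
      _ = (1 / α + 2 / α ^ 2) / 2 * (t ^ 3)⁻¹ := by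
          rw [htt]
          field_simp
      _ = _ := by
          congr 1
          rw [Real.rpow_neg hm.le, ht, Real.sqrt_eq_rpow, ← Real.rpow_mul_natCast hm.le]
          norm_num
  refine ⟨(1 / α + 2 / α ^ 2) / 2 * 3 ^ (3 / 2 : ℝ), by positivity, fun n v => ?_⟩
  have h1 : ((μ ^ n).coeff v : ℝ)
      ≤ (1 / α + 2 / α ^ 2) / 2 * (((n / 3 : ℕ) : ℝ) + 1) ^ (-(3 / 2) : ℝ) := by
    -- The leftover factor has total mass 1, so it cannot raise the bound on atoms.
    have e : μ ^ n = (μ ^ 3) ^ (n / 3) * μ ^ (n % 3) := by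
      rw [← pow_mul, ← pow_add, Nat.div_add_mod]
    have h2 := coeff_mul_le
      (M := ((1 / α + 2 / α ^ 2) / 2 * (((n / 3 : ℕ) : ℝ) + 1) ^ (-(3 / 2) : ℝ)).toNNReal)
      (fun w => NNReal.le_toNNReal_of_coe_le (hcube (n / 3) w)) (μ ^ (n % 3)) v
    rw [map_pow, hμ, one_pow, mul_one] at h2
    rw [e]
    rw [← NNReal.coe_le_coe, Real.coe_toNNReal _ (by positivity)] at h2
    exact h2
  refine h1.trans ?_
  rw [mul_assoc]
  refine mul_le_mul_of_nonneg_left ?_ (by positivity)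
  have h3 : ((n : ℝ) + 1) / 3 ≤ ((n / 3 : ℕ) : ℝ) + 1 := by
    have : n + 1 ≤ 3 * (n / 3 + 1) := by omega
    have : (n : ℝ) + 1 ≤ 3 * (((n / 3 : ℕ) : ℝ) + 1) := by exact_mod_cast this
    linarith
  calc (((n / 3 : ℕ) : ℝ) + 1) ^ (-(3 / 2) : ℝ)
      ≤ (((n : ℝ) + 1) / 3) ^ (-(3 / 2) : ℝ) :=
        Real.rpow_le_rpow_of_nonpos (by positivity) h3 (by norm_num)
    _ = 3 ^ (3 / 2 : ℝ) * ((n : ℝ) + 1) ^ (-(3 / 2) : ℝ) := by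
        rw [Real.div_rpow (by positivity) (by norm_num), Real.rpow_neg (by norm_num : (0:ℝ) ≤ 3)]
        field_simp

end Concentration

/-! ### The tilted distribution and its support -/

section Tilted

variable {𝒳 : Type*} [Fintype 𝒳] {k : ℕ}

theorem sum_pmf_toReal (q : PMF 𝒳) : ∑ x, (q x).toReal = 1 := by
  rw [← ENNReal.toReal_sum fun x _ => q.apply_ne_top x, ← tsum_fintype (L := .unconditional 𝒳),
    q.tsum_coe, ENNReal.toReal_one]

theorem partitionFn_pos (q : PMF 𝒳) (T : 𝒳 → Fin k → ℝ) (β : Fin k → ℝ) :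
    0 < partitionFn q T β := by
  have hnn : ∀ x, 0 ≤ (q x).toReal * Real.exp (-(β ⬝ᵥ T x)) := fun x => by positivity
  refine lt_of_le_of_ne (Finset.sum_nonneg fun x _ => hnn x) fun h => ?_
  have h0 := (Finset.sum_eq_zero_iff_of_nonneg fun x _ => hnn x).1 h.symm
  have h1 := sum_pmf_toReal q
  rw [Finset.sum_eq_zero fun x hx => ?_] at h1
  · exact zero_ne_one h1
  · exact (mul_eq_zero.1 (h0 x hx)).resolve_right (Real.exp_pos _).ne'

theorem tiltedMass_nonneg (q : PMF 𝒳) (T : 𝒳 → Fin k → ℝ) (β : Fin k → ℝ) (x : 𝒳) :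
    0 ≤ tiltedMass q T β x := by
  have := (partitionFn_pos q T β).le
  unfold tiltedMass
  positivity

theorem sum_tiltedMass (q : PMF 𝒳) (T : 𝒳 → Fin k → ℝ) (β : Fin k → ℝ) :
    ∑ x, tiltedMass q T β x = 1 := by
  simp only [tiltedMass, ← mul_div_assoc]
  rw [← Finset.sum_div]
  exact div_self (partitionFn_pos q T β).ne'

/-- By bilinearity, applying the matrix to `w` gives the covariances with the scalar variable `T x
⬝ᵥ w`. -/
theorem covMatrix_mulVec {p : 𝒳 → ℝ} (T : 𝒳 → Fin k → ℝ) (w : Fin k → ℝ) (i : Fin k) :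
    (covMatrix p T).mulVec w i
      = expect p (fun x => T x i * (T x ⬝ᵥ w)) - expect p (fun x => T x i)
        * expect p (fun x => T x ⬝ᵥ w) := by
  have h : ∀ g : 𝒳 → ℝ, expect p (fun x => g x * (T x ⬝ᵥ w))
      = ∑ j, expect p (fun x => g x * T x j) * w j := by
    intro g
    simp only [expect, dotProduct, Finset.mul_sum, Finset.sum_mul]
    rw [Finset.sum_comm]
    refine Finset.sum_congr rfl fun j _ => Finset.sum_congr rfl fun x _ => ?_
    ring
  have h1 := h fun _ => 1
  simp only [one_mul] at h1
  rw [h, h1, Finset.mul_sum, ← Finset.sum_sub_distrib, Matrix.mulVec, dotProduct]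
  refine Finset.sum_congr rfl fun j _ => ?_
  rw [covMatrix, Matrix.of_apply]
  ring

/-- An invertible covariance matrix forces the support to span: the differences of `T` from a
fixed support point generate the whole space. -/
theorem span_differences_eq_top {p : 𝒳 → ℝ} (hp0 : ∀ x, 0 ≤ p x) (hp1 : ∑ x, p x = 1)
    {T : 𝒳 → Fin k → ℝ} (hcov : IsUnit (covMatrix p T)) (x₀ : 𝒳) :
    Submodule.span ℝ ((fun x => T x - T x₀) '' {x | 0 < p x}) = ⊤ := by
  by_contra hne
  obtain ⟨f, hf0, hf⟩ := Submodule.exists_le_ker_of_lt_top _ (lt_top_iff_ne_top.2 hne)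
  refine hf0 ?_
  set w : Fin k → ℝ := fun j => f (Pi.single j 1) with hw
  have hfw : ∀ v, f v = v ⬝ᵥ w := by
    intro v
    rw [LinearMap.pi_apply_eq_sum_univ f v]
    refine Finset.sum_congr rfl fun j _ => ?_
    rw [smul_eq_mul, hw]
    congr 2
    funext i
    simp [Pi.single_apply, eq_comm]
  -- Since `f` kills the differences, `T x ⬝ᵥ w` is constant on the support; its covariances vanish
  -- and `w` lies in the kernel.
  have hc : ∀ (g : 𝒳 → ℝ), expect p (fun x => g x * (T x ⬝ᵥ w))
      = expect p g * (T x₀ ⬝ᵥ w) := by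
    intro g
    rw [expect, expect, Finset.sum_mul]
    refine Finset.sum_congr rfl fun x _ => ?_
    rcases (hp0 x).eq_or_lt with h | h
    · simp [← h]
    · have h1 : f (T x - T x₀) = 0 := hf (Submodule.subset_span ⟨x, h, rfl⟩)
      rw [map_sub, sub_eq_zero, hfw, hfw] at h1
      rw [h1]
      ring
  have hw0 : (covMatrix p T).mulVec w = (covMatrix p T).mulVec 0 := by
    rw [Matrix.mulVec_zero]
    funext i
    have h1 := hc fun _ => 1
    simp only [one_mul] at h1
    have h2 : expect p (fun _ => 1) = 1 := by simp [expect, hp1]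
    rw [covMatrix_mulVec, hc, h1, h2, one_mul, sub_self, Pi.zero_apply]
  have := Matrix.mulVec_injective_iff_isUnit.2 hcov hw0
  ext j
  simpa [hw] using congrFun this j

theorem exists_simplex_in_support {p : 𝒳 → ℝ} (hp0 : ∀ x, 0 ≤ p x) (hp1 : ∑ x, p x = 1)
    {T : 𝒳 → Fin k → ℝ} (hcov : IsUnit (covMatrix p T)) (hk : 2 < k) :
    ∃ (x₀ : 𝒳) (x : Fin 3 → 𝒳), 0 < p x₀ ∧ (∀ i, 0 < p (x i)) ∧
      LinearIndependent ℝ fun i => T (x i) - T x₀ := by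
  obtain ⟨x₀, -, hx₀⟩ : ∃ x ∈ Finset.univ, 0 < p x := by
    apply Finset.exists_lt_of_sum_lt
    simp [hp1]
  have hspan := span_differences_eq_top hp0 hp1 hcov x₀
  obtain ⟨f, hf, -, hli⟩ := Submodule.exists_fun_fin_finrank_span_eq ℝ
    ((fun x => T x - T x₀) '' {x | 0 < p x})
  have hrank : 3 ≤ Module.finrank ℝ
      (Submodule.span ℝ ((fun x => T x - T x₀) '' {x | 0 < p x})) := by
    rw [hspan, finrank_top, Module.finrank_fin_fun]
    exact hk
  choose x hx hxf using hf
  refine ⟨x₀, fun i => x (Fin.castLE hrank i), hx₀, fun i => hx _, ?_⟩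
  have heq : (fun i => T (x (Fin.castLE hrank i)) - T x₀) = f ∘ Fin.castLE hrank :=
    funext fun i => hxf _
  rw [heq]
  exact hli.comp _ (Fin.castLE_injective hrank)

end Tilted

/-! ### The law of the sum of a sample -/

section Law

variable {𝒳 V : Type*} [Fintype 𝒳] [AddCommGroup V]

/-- The law of `T` under the mass function `p`, as an element of the group algebra. -/
def lawOf (p : 𝒳 → ℝ≥0) (T : 𝒳 → V) : AddMonoidAlgebra ℝ≥0 V :=
  ∑ x, AddMonoidAlgebra.single (T x) (p x)

theorem totalMass_lawOf (p : 𝒳 → ℝ≥0) (T : 𝒳 → V) : totalMass V (lawOf p T) = ∑ x, p x := by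
  simp [lawOf, totalMass_single]

omit [AddCommGroup V] in
theorem le_coeff_lawOf (p : 𝒳 → ℝ≥0) (T : 𝒳 → V) (x : 𝒳) : p x ≤ (lawOf p T).coeff (T x) := by
  classical
  rw [lawOf, AddMonoidAlgebra.coeff_sum, Finsupp.finsetSum_apply]
  refine le_trans ?_ (Finset.single_le_sum (fun _ _ => zero_le) (Finset.mem_univ x))
  simp

theorem coeff_lawOf_pow [DecidableEq V] (p : 𝒳 → ℝ≥0) (T : 𝒳 → V) (n : ℕ) (v : V) :
    (lawOf p T ^ n).coeff v
      = ∑ x : Fin n → 𝒳 with ∑ i, T (x i) = v, ∏ i, p (x i) := by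
  have h : lawOf p T ^ n
      = ∑ x : Fin n → 𝒳, AddMonoidAlgebra.single (∑ i, T (x i)) (∏ i, p (x i)) := by
    have := Finset.prod_univ_sum (fun _ : Fin n => (Finset.univ : Finset 𝒳))
      (fun _ x => AddMonoidAlgebra.single (T x) (p x))
    rw [Finset.prod_const, Finset.card_univ, Fintype.card_fin, Fintype.piFinset_univ] at this
    rw [lawOf, this]
    exact Finset.sum_congr rfl fun x _ => AddMonoidAlgebra.prod_single _ _ _
  rw [h, AddMonoidAlgebra.coeff_sum, Finsupp.finsetSum_apply, Finset.sum_filter]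
  simp only [AddMonoidAlgebra.coeff_single, Finsupp.single_apply]

end Law

open MeasureTheory Filter

section Sequences

variable {𝒳 : Type*} [MeasurableSpace 𝒳]

/-! ### Independent sequences -/

section Iid

/-- The distribution of an independent sequence with common law `m`. -/
def iid (m : Measure 𝒳) [IsProbabilityMeasure m] : Measure (ℕ → 𝒳) :=
  Measure.infinitePi fun _ => m

instance (m : Measure 𝒳) [IsProbabilityMeasure m] : IsProbabilityMeasure (iid m) := by
  unfold iid; infer_instance

theorem seqMass_iid [MeasurableSingletonClass 𝒳] (m : Measure 𝒳) [IsProbabilityMeasure m] {n : ℕ}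
    (x : Fin n → 𝒳) : seqMass (iid m) x = ∏ i, m {x i} := by
  set s : ℕ → Set 𝒳 := fun i => if h : i < n then {x ⟨i, h⟩} else Set.univ with hs
  have h1 : {ω : ℕ → 𝒳 | ∀ i : Fin n, ω i = x i} = Set.pi (Finset.range n) s := by
    ext ω
    simp only [Set.mem_ofPred_eq, Set.mem_pi, Finset.coe_range, Set.mem_Iio, hs]
    refine ⟨fun h i hi => ?_, fun h i => ?_⟩
    · simpa [hi] using h ⟨i, hi⟩
    · simpa using h i i.2
  rw [seqMass, h1, iid, Measure.infinitePi_pi, Finset.prod_range]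
  · simp [hs]
  · intro i _
    simp only [hs]
    split_ifs
    · exact measurableSet_singleton _
    · exact MeasurableSet.univ

theorem measurePreserving_shift (m : Measure 𝒳) [IsProbabilityMeasure m] (n : ℕ) :
    MeasurePreserving (fun (ω : ℕ → 𝒳) i => ω (i + n)) (iid m) (iid m) := by
  have hmeas : Measurable fun (ω : ℕ → 𝒳) i => ω (i + n) := by fun_prop
  refine ⟨hmeas, Measure.eq_infinitePi _ fun s t ht => ?_⟩
  have hpre : (fun (ω : ℕ → 𝒳) i => ω (i + n)) ⁻¹' Set.pi s t
      = Set.pi (s.map (addRightEmbedding n)) fun i => t (i - n) := by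
    ext ω
    simp [Set.mem_pi]
  rw [Measure.map_apply hmeas (MeasurableSet.pi s.countable_toSet fun i _ => ht i), hpre, iid,
    Measure.infinitePi_pi _ fun i _ => ht _, Finset.prod_map]
  simp

end Iid

/-! ### Return times -/

section Return

variable {k : ℕ}

/-- The event that the first `n` outcomes satisfy the constraint. -/
def constraintEvent (T : 𝒳 → Fin k → ℝ) (t : Fin k → ℝ) (n : ℕ) : Set (ℕ → 𝒳) :=
  {ω | (fun i : Fin n => ω i) ∈ constraintSet T t n}

omit [MeasurableSpace 𝒳] in
theorem mem_constraintSet_iff {T : 𝒳 → Fin k → ℝ} {t : Fin k → ℝ} {n : ℕ} (hn : 1 ≤ n)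
    {x : Fin n → 𝒳} : x ∈ constraintSet T t n ↔ ∑ i, T (x i) = n • t := by
  have hn' : (n : ℝ) ≠ 0 := by positivity
  rw [constraintSet, Set.mem_ofPred_eq, inv_smul_eq_iff₀ hn', Nat.cast_smul_eq_nsmul]

omit [MeasurableSpace 𝒳] in
theorem mem_constraintEvent_iff {T : 𝒳 → Fin k → ℝ} {t : Fin k → ℝ} {n : ℕ} (hn : 1 ≤ n)
    {ω : ℕ → 𝒳} : ω ∈ constraintEvent T t n ↔ ∑ i ∈ Finset.range n, T (ω i) = n • t := by
  rw [constraintEvent, Set.mem_ofPred_eq, mem_constraintSet_iff hn,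
    Finset.sum_range fun i => T (ω i)]

omit [MeasurableSpace 𝒳] in
theorem add_mem_constraintEvent {T : 𝒳 → Fin k → ℝ} {t : Fin k → ℝ} {n m : ℕ} (hm : 1 ≤ m)
    (hn : 1 ≤ n) {ω : ℕ → 𝒳} (h : ω ∈ constraintEvent T t m)
    (h' : (fun i => ω (i + m)) ∈ constraintEvent T t n) : ω ∈ constraintEvent T t (m + n) := by
  rw [mem_constraintEvent_iff (by omega)] at *
  rw [Finset.sum_range_add, h, add_smul, ← h']
  simp only [add_comm m]

theorem measurableSet_constraintEvent [Finite 𝒳] [MeasurableSingletonClass 𝒳]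
    (T : 𝒳 → Fin k → ℝ) (t : Fin k → ℝ) (n : ℕ) : MeasurableSet (constraintEvent T t n) := by
  have hmeas : Measurable fun (ω : ℕ → 𝒳) (i : Fin n) => ω i := by fun_prop
  exact hmeas (Set.toFinite (constraintSet T t n)).measurableSet

theorem measure_constraintEvent_le [Fintype 𝒳] [DecidableEq (Fin k → ℝ)] (P : Measure (ℕ → 𝒳))
    (T : 𝒳 → Fin k → ℝ) (t : Fin k → ℝ) {n : ℕ} (hn : 1 ≤ n) :
    P (constraintEvent T t n) ≤ ∑ x : Fin n → 𝒳 with ∑ i, T (x i) = n • t, seqMass P x := by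
  refine le_trans (measure_mono ?_) (measure_biUnion_finset_le _ _)
  intro ω hω
  rw [constraintEvent, Set.mem_ofPred_eq, mem_constraintSet_iff hn] at hω
  simp only [Set.mem_iUnion, Finset.mem_filter, Finset.mem_univ, true_and]
  exact ⟨_, hω, fun _ => rfl⟩

/-- A walk whose return probabilities are summable is transient. -/
theorem measure_iUnion_constraintEvent_lt_one [Finite 𝒳] [MeasurableSingletonClass 𝒳]
    (m : Measure 𝒳) [IsProbabilityMeasure m] (T : 𝒳 → Fin k → ℝ) (t : Fin k → ℝ)
    (hsum : ∑' n, iid m (constraintEvent T t (n + 1)) ≠ ∞) :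
    iid m (⋃ n, constraintEvent T t (n + 1)) < 1 := by
  refine lt_of_le_of_ne prob_le_one fun h => ?_
  have hE : ∀ᵐ ω ∂iid m, ω ∈ ⋃ n, constraintEvent T t (n + 1) :=
    (mem_ae_iff_prob_eq_one (MeasurableSet.iUnion fun n =>
      measurableSet_constraintEvent T t (n + 1))).2 h
  -- If return were certain, shift invariance would make it certain from every starting time.
  -- Concatenated returns then give infinitely many, against Borel–Cantelli.
  have hshift : ∀ᵐ ω ∂iid m, ∀ n : ℕ,
      (fun i => ω (i + n)) ∈ ⋃ n, constraintEvent T t (n + 1) :=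
    ae_all_iff.2 fun n => (measurePreserving_shift m n).quasiMeasurePreserving.ae hE
  obtain ⟨ω, hω, hfin⟩ := (hshift.and (ae_eventually_notMem hsum)).exists
  obtain ⟨N, hN⟩ := eventually_atTop.1 hfin
  have hlarge : ∀ j : ℕ, ∃ n, j ≤ n ∧ ω ∈ constraintEvent T t (n + 1) := by
    intro j
    induction j with
    | zero =>
      obtain ⟨n, hn⟩ := Set.mem_iUnion.1 (hω 0)
      exact ⟨n, Nat.zero_le n, hn⟩
    | succ j ih =>
      obtain ⟨n, hjn, hn⟩ := ih
      obtain ⟨l, hl⟩ := Set.mem_iUnion.1 (hω (n + 1))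
      exact ⟨n + 1 + l, by omega, add_mem_constraintEvent (n := l + 1) (by omega) (by omega) hn hl⟩
  obtain ⟨n, hn, hmem⟩ := hlarge N
  exact hN n hn hmem

end Return

/-! ### Comparison of mass functions -/

section Comparison

theorem lt_log2_of_lt {c : ℝ} {r : ℝ≥0∞} (h : ENNReal.ofReal (2 ^ c) < r) :
    (c : EReal) < log2 r := by
  have hlog : (0 : ℝ) < Real.log 2 := Real.log_pos one_lt_two
  rw [log2, EReal.lt_div_iff (by exact_mod_cast hlog) (EReal.coe_ne_top _)]
  have h1 := ENNReal.log_lt_log h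
  rwa [ENNReal.log_ofReal_of_pos (by positivity), Real.log_rpow two_pos, EReal.coe_mul] at h1

theorem isProbabilityMeasure_normalize {M : Measure (ℕ → 𝒳)} (h0 : M Set.univ ≠ 0)
    (h1 : M Set.univ ≠ ∞) : IsProbabilityMeasure ((M Set.univ)⁻¹ • M) :=
  ⟨by rw [Measure.smul_apply, smul_eq_mul, ENNReal.inv_mul_cancel h0 h1]⟩

/-- If a finite measure gives a sample the mass `u + w p(x)` with `u > 0`, its normalization
beats `p(x)` by any factor not exceeding `w` over the total mass, even when `p(x) = 0`. -/
theorem lt_log2_seqMass_normalize_div {M : Measure (ℕ → 𝒳)}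
    (h1 : M Set.univ ≠ ∞) {p : 𝒳 → ℝ} {n : ℕ} {x : Fin n → 𝒳} {u w : ℝ≥0∞}
    (hu : u ≠ 0) (hM : u + w * productMass p x ≤ seqMass M x) {c : ℝ}
    (hc : ENNReal.ofReal (2 ^ c) ≤ (M Set.univ)⁻¹ * w) :
    (c : EReal) < log2 (seqMass ((M Set.univ)⁻¹ • M) x / productMass p x) := by
  apply lt_log2_of_lt
  have hp : productMass p x ≠ ∞ := ENNReal.ofReal_ne_top
  rw [ENNReal.lt_div_iff_mul_lt (Or.inr ENNReal.ofReal_ne_top) (Or.inl hp)]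
  have hinv : (M Set.univ)⁻¹ ≠ 0 := ENNReal.inv_ne_zero.2 h1
  have h2 : seqMass ((M Set.univ)⁻¹ • M) x = (M Set.univ)⁻¹ * seqMass M x := by
    simp [seqMass]
  -- Strictness comes from `u` alone.
  calc ENNReal.ofReal (2 ^ c) * productMass p x
      < (M Set.univ)⁻¹ * u + ENNReal.ofReal (2 ^ c) * productMass p x :=
        (ENNReal.lt_add_right (ENNReal.mul_ne_top ENNReal.ofReal_ne_top hp)
          (mul_ne_zero hinv hu)).trans_eq (add_comm _ _)
    _ ≤ (M Set.univ)⁻¹ * u + (M Set.univ)⁻¹ * w * productMass p x := by gcongr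
    _ = (M Set.univ)⁻¹ * (u + w * productMass p x) := by ring
    _ ≤ seqMass ((M Set.univ)⁻¹ • M) x := by rw [h2]; gcongr

omit [MeasurableSpace 𝒳] in
theorem cylinder_subset_constraintEvent {k : ℕ} {T : 𝒳 → Fin k → ℝ} {t : Fin k → ℝ} {n : ℕ}
    {x : Fin n → 𝒳} (hx : x ∈ constraintSet T t n) :
    {ω : ℕ → 𝒳 | ∀ i : Fin n, ω i = x i} ⊆ constraintEvent T t n := by
  intro ω hω
  have : (fun i : Fin n => ω i) = x := funext hω
  rwa [constraintEvent, Set.mem_ofPred_eq, this]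

theorem seqMass_restrict {P : Measure (ℕ → 𝒳)} {n : ℕ} {x : Fin n → 𝒳} {E : Set (ℕ → 𝒳)}
    (hE : MeasurableSet E) (hx : {ω : ℕ → 𝒳 | ∀ i : Fin n, ω i = x i} ⊆ E) :
    seqMass (P.restrict E) x = seqMass P x := by
  rw [seqMass, Measure.restrict_apply' hE, Set.inter_eq_left.2 hx, seqMass]

end Comparison

end Sequences

/-! ### Return probabilities and the two improving distributions -/

section Main

variable {𝒳 : Type*} [Fintype 𝒳] {k : ℕ}

/-- The tilted distribution, as a probability mass function. -/
def tiltedPMF (q : PMF 𝒳) (T : 𝒳 → Fin k → ℝ) (β : Fin k → ℝ) : PMF 𝒳 :=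
  PMF.ofFintype (fun x => ENNReal.ofReal (tiltedMass q T β x)) <| by
    rw [← ENNReal.ofReal_sum_of_nonneg fun x _ => tiltedMass_nonneg q T β x, sum_tiltedMass,
      ENNReal.ofReal_one]

variable [MeasurableSpace 𝒳] [MeasurableSingletonClass 𝒳]

theorem seqMass_iid_tiltedPMF (q : PMF 𝒳) (T : 𝒳 → Fin k → ℝ) (β : Fin k → ℝ) {n : ℕ}
    (x : Fin n → 𝒳) :
    seqMass (iid (tiltedPMF q T β).toMeasure) x = productMass (tiltedMass q T β) x := by
  rw [seqMass_iid, productMass,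
    ENNReal.ofReal_prod_of_nonneg fun i _ => tiltedMass_nonneg q T β (x i)]
  refine Finset.prod_congr rfl fun i _ => ?_
  rw [PMF.toMeasure_apply_singleton _ _ (measurableSet_singleton _)]
  rfl

theorem seqMass_iid_uniform_ne_zero [Nonempty 𝒳] {n : ℕ} (x : Fin n → 𝒳) :
    seqMass (iid (PMF.uniformOfFintype 𝒳).toMeasure) x ≠ 0 := by
  rw [seqMass_iid]
  refine Finset.prod_ne_zero_iff.2 fun i _ => ?_
  rw [PMF.toMeasure_apply_singleton _ _ (measurableSet_singleton _)]
  simp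

/-- The probability that the constraint holds at time `n` is `O(n ^ (-3/2))`. -/
theorem exists_measure_constraintEvent_le (hk : 2 < k) (q : PMF 𝒳) (T : 𝒳 → Fin k → ℝ)
    (t β : Fin k → ℝ) (hcov : IsUnit (covMatrix (tiltedMass q T β) T)) :
    ∃ C : ℝ, 0 < C ∧ ∀ n : ℕ, 1 ≤ n →
      iid (tiltedPMF q T β).toMeasure (constraintEvent T t n)
        ≤ ENNReal.ofReal (C * ((n : ℝ) + 1) ^ (-(3 / 2) : ℝ)) := by
  classical
  have hp0 := tiltedMass_nonneg q T β
  have hp1 := sum_tiltedMass q T β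
  set p : 𝒳 → ℝ≥0 := fun x => (tiltedMass q T β x).toNNReal with hp
  have hpc : ∀ x, (p x : ℝ) = tiltedMass q T β x := fun x => Real.coe_toNNReal _ (hp0 x)
  obtain ⟨x₀, x, hx₀, hx, hli⟩ := exists_simplex_in_support hp0 hp1 hcov hk
  have hmass : totalMass _ (lawOf p T) = 1 := by
    rw [totalMass_lawOf, ← NNReal.coe_inj, NNReal.coe_sum, NNReal.coe_one, ← hp1]
    exact Finset.sum_congr rfl fun x _ => hpc x
  obtain ⟨C, hC, hbound⟩ := exists_coeff_pow_le (a := fun i => T (x i)) hmass hli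
    ((Real.toNNReal_pos.2 hx₀).trans_le (le_coeff_lawOf p T x₀))
    (fun i => (Real.toNNReal_pos.2 (hx i)).trans_le (le_coeff_lawOf p T (x i)))
  refine ⟨C, hC, fun n hn => (measure_constraintEvent_le _ T t hn).trans ?_⟩
  have h1 : ∑ x : Fin n → 𝒳 with ∑ i, T (x i) = n • t,
      seqMass (iid (tiltedPMF q T β).toMeasure) x
        = ENNReal.ofReal ((lawOf p T ^ n).coeff (n • t)) := by
    rw [coeff_lawOf_pow, NNReal.coe_sum, ENNReal.ofReal_sum_of_nonneg fun _ _ => NNReal.coe_nonneg _]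
    refine Finset.sum_congr rfl fun x _ => ?_
    rw [seqMass_iid_tiltedPMF, productMass, NNReal.coe_prod]
    simp only [hpc]
  rw [h1]
  exact ENNReal.ofReal_le_ofReal (hbound n _)

omit [Fintype 𝒳] [MeasurableSingletonClass 𝒳] in
-- The weight leaves the exponent `1/4 - 3/2 = -5/4`, still below `-1`.
theorem tsum_weighted_constraintEvent_ne_top {P : Measure (ℕ → 𝒳)} {T : 𝒳 → Fin k → ℝ}
    {t : Fin k → ℝ} {C : ℝ}
    (hP : ∀ n : ℕ, 1 ≤ n →
      P (constraintEvent T t n) ≤ ENNReal.ofReal (C * ((n : ℝ) + 1) ^ (-(3 / 2) : ℝ))) :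
    ∑' n : ℕ, ENNReal.ofReal ((n : ℝ) ^ (1 / 4 : ℝ)) * P (constraintEvent T t n) ≠ ∞ := by
  have hsum : Summable fun n : ℕ => C * ((n : ℝ) + 1) ^ (-(5 / 4) : ℝ) := by
    have h := (summable_nat_add_iff 1).2
      ((Real.summable_nat_rpow (p := -(5 / 4))).2 (by norm_num))
    refine (h.mul_left C).congr fun n => ?_
    push_cast
    rfl
  refine ne_top_of_le_ne_top hsum.tsum_ofReal_ne_top (ENNReal.tsum_le_tsum fun n => ?_)
  -- At `n = 0`, where `hP` says nothing, the weight vanishes.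
  rcases Nat.eq_zero_or_pos n with rfl | hn
  · simp [Real.zero_rpow]
  refine (mul_le_mul_right (hP n hn) _).trans ?_
  rw [← ENNReal.ofReal_mul (by positivity)]
  by_cases hC : 0 ≤ C
  · refine ENNReal.ofReal_le_ofReal ?_
    have hpos : (0 : ℝ) < (n : ℝ) + 1 := by positivity
    calc (n : ℝ) ^ (1 / 4 : ℝ) * (C * ((n : ℝ) + 1) ^ (-(3 / 2) : ℝ))
        ≤ ((n : ℝ) + 1) ^ (1 / 4 : ℝ) * (C * ((n : ℝ) + 1) ^ (-(3 / 2) : ℝ)) := by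
          gcongr
          linarith
      _ = C * ((n : ℝ) + 1) ^ (-(5 / 4) : ℝ) := by
          rw [mul_left_comm, ← Real.rpow_add hpos]
          norm_num
  · rw [ENNReal.ofReal_of_nonpos]
    · exact zero_le
    · exact mul_nonpos_of_nonneg_of_nonpos (by positivity)
        (mul_nonpos_of_nonpos_of_nonneg (not_le.1 hC).le (by positivity))

theorem exists_logarithmic_gain (q : PMF 𝒳) (T : 𝒳 → Fin k → ℝ) (t β : Fin k → ℝ)
    (hsum : ∑' n : ℕ, ENNReal.ofReal ((n : ℝ) ^ (1 / 4 : ℝ))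
      * iid (tiltedPMF q T β).toMeasure (constraintEvent T t n) ≠ ∞) :
    ∃ P' : Measure (ℕ → 𝒳), IsProbabilityMeasure P' ∧
      ∃ c : ℝ, 0 < c ∧ ∀ᶠ n : ℕ in atTop, ∀ x ∈ constraintSet T t n,
        ((c * Real.logb 2 n : ℝ) : EReal) <
          log2 (seqMass P' x / productMass (tiltedMass q T β) x) := by
  have : Nonempty 𝒳 := q.support_nonempty.to_type
  set P := iid (tiltedPMF q T β).toMeasure
  set U := iid (PMF.uniformOfFintype 𝒳).toMeasure
  set M : Measure (ℕ → 𝒳) := U + Measure.sum fun n : ℕ =>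
    ENNReal.ofReal ((n : ℝ) ^ (1 / 4 : ℝ)) • P.restrict (constraintEvent T t n) with hMdef
  have hMuniv : M Set.univ = 1 + ∑' n : ℕ, ENNReal.ofReal ((n : ℝ) ^ (1 / 4 : ℝ))
      * P (constraintEvent T t n) := by
    rw [hMdef, Measure.add_apply, measure_univ, Measure.sum_apply _ MeasurableSet.univ]
    simp
  have hM1 : M Set.univ ≠ ∞ := by
    rw [hMuniv]
    exact ENNReal.add_ne_top.2 ⟨ENNReal.one_ne_top, hsum⟩
  have hM0 : M Set.univ ≠ 0 := by
    rw [hMuniv]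
    exact (add_pos_of_pos_of_nonneg one_pos zero_le).ne'
  -- Half of the exponent `1/4` eventually pays for the normalizing constant; the other half is the
  -- gain.
  refine ⟨_, isProbabilityMeasure_normalize hM0 hM1, 1 / 8, by norm_num, ?_⟩
  have hlarge : ∀ᶠ n : ℕ in atTop, (M Set.univ).toReal ≤ (n : ℝ) ^ (1 / 8 : ℝ) :=
    ((tendsto_rpow_atTop (by norm_num : (0 : ℝ) < 1 / 8)).comp
      tendsto_natCast_atTop_atTop).eventually_ge_atTop _
  filter_upwards [hlarge, eventually_ge_atTop 1] with n hn hn1 x hx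
  have hn0 : (0 : ℝ) < n := by exact_mod_cast hn1
  refine lt_log2_seqMass_normalize_div (u := seqMass U x)
    (w := ENNReal.ofReal ((n : ℝ) ^ (1 / 4 : ℝ))) hM1 (seqMass_iid_uniform_ne_zero x) ?_ ?_
  · rw [← seqMass_iid_tiltedPMF]
    have h1 : seqMass M x = seqMass U x + seqMass (Measure.sum fun n : ℕ =>
        ENNReal.ofReal ((n : ℝ) ^ (1 / 4 : ℝ)) • P.restrict (constraintEvent T t n)) x := rfl
    rw [h1]
    gcongr
    refine le_trans (le_of_eq ?_) (Measure.le_iff'.1 (Measure.le_sum _ n) _)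
    rw [Measure.smul_apply, smul_eq_mul]
    congr 1
    exact (seqMass_restrict (measurableSet_constraintEvent T t n)
      (cylinder_subset_constraintEvent hx)).symm
  · have e : (2 : ℝ) ^ (1 / 8 * Real.logb 2 n) = (n : ℝ) ^ (1 / 8 : ℝ) := by
      rw [mul_comm, Real.rpow_mul two_pos.le, Real.rpow_logb two_pos (by norm_num) hn0]
    rw [e, mul_comm, ← div_eq_mul_inv, ENNReal.le_div_iff_mul_le (Or.inl hM0) (Or.inl hM1),
      ← ENNReal.ofReal_toReal hM1, ← ENNReal.ofReal_mul (by positivity)]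
    refine ENNReal.ofReal_le_ofReal ?_
    calc (n : ℝ) ^ (1 / 8 : ℝ) * (M Set.univ).toReal
        ≤ (n : ℝ) ^ (1 / 8 : ℝ) * (n : ℝ) ^ (1 / 8 : ℝ) := by gcongr
      _ = (n : ℝ) ^ (1 / 4 : ℝ) := by
        rw [← Real.rpow_add hn0]
        norm_num

theorem exists_constant_gain (q : PMF 𝒳) (T : 𝒳 → Fin k → ℝ) (t β : Fin k → ℝ)
    (hsum : ∑' n : ℕ, iid (tiltedPMF q T β).toMeasure (constraintEvent T t (n + 1)) ≠ ∞) :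
    ∃ P'' : Measure (ℕ → 𝒳), IsProbabilityMeasure P'' ∧
      ∃ c : ℝ, 0 < c ∧ ∀ n : ℕ, 1 ≤ n → ∀ x ∈ constraintSet T t n,
        (c : EReal) < log2 (seqMass P'' x / productMass (tiltedMass q T β) x) := by
  have : Nonempty 𝒳 := q.support_nonempty.to_type
  have hlt := measure_iUnion_constraintEvent_lt_one (tiltedPMF q T β).toMeasure T t hsum
  set P := iid (tiltedPMF q T β).toMeasure
  set U := iid (PMF.uniformOfFintype 𝒳).toMeasure
  set E := ⋃ n, constraintEvent T t (n + 1) with hE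
  have hEm : MeasurableSet E := MeasurableSet.iUnion fun n =>
    measurableSet_constraintEvent T t (n + 1)
  -- The gap `r - P E` is the mass given to the uniform component, while `r < 1` keeps the gain `log
  -- (1 / r)` positive.
  obtain ⟨r, hr, hr1⟩ := exists_between hlt
  set δ := r - P E with hδ
  have hδ0 : δ ≠ 0 := (tsub_pos_of_lt hr).ne'
  set M : Measure (ℕ → 𝒳) := δ • U + P.restrict E with hMdef
  have hMuniv : M Set.univ = r := by
    rw [hMdef, Measure.add_apply, Measure.smul_apply, measure_univ, Measure.restrict_apply_univ,
      smul_eq_mul, mul_one, hδ, tsub_add_cancel_of_le hr.le]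
  have hM1 : M Set.univ ≠ ∞ := hMuniv ▸ hr1.ne_top
  have hr0 : r ≠ 0 := (zero_le.trans_lt hr).ne'
  have hM0 : M Set.univ ≠ 0 := hMuniv ▸ hr0
  have hrpos : 0 < r.toReal := ENNReal.toReal_pos hr0 hr1.ne_top
  have hrlt : r.toReal < 1 := by
    rw [← ENNReal.toReal_one]
    exact (ENNReal.toReal_lt_toReal hr1.ne_top ENNReal.one_ne_top).2 hr1
  refine ⟨_, isProbabilityMeasure_normalize hM0 hM1, Real.logb 2 (r.toReal)⁻¹,
    Real.logb_pos one_lt_two ((one_lt_inv₀ hrpos).2 hrlt), fun n hn x hx => ?_⟩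
  refine lt_log2_seqMass_normalize_div (u := δ * seqMass U x) (w := 1) hM1
    (mul_ne_zero hδ0 (seqMass_iid_uniform_ne_zero x)) ?_ ?_
  · have hsub : constraintEvent T t n ⊆ E := by
      obtain ⟨n, rfl⟩ := Nat.exists_eq_add_of_le' hn
      exact Set.subset_iUnion (fun n => constraintEvent T t (n + 1)) n
    rw [one_mul, ← seqMass_iid_tiltedPMF,
      ← seqMass_restrict (P := P) hEm ((cylinder_subset_constraintEvent hx).trans hsub)]
    exact le_of_eq rfl
  · rw [Real.rpow_logb two_pos (by norm_num) (inv_pos.2 hrpos), hMuniv, mul_one,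
      ENNReal.ofReal_inv_of_pos hrpos, ENNReal.ofReal_toReal hr1.ne_top]

end Main

end MaxEnt

end

theorem theorem4 {𝒳 : Type*} [Fintype 𝒳] [MeasurableSpace 𝒳] [MeasurableSingletonClass 𝒳]
    {k : ℕ} (hk : 2 < k) (q : PMF 𝒳) (T : 𝒳 → Fin k → ℝ) (hT : MaxEnt.IsLattice T)
    (t β : Fin k → ℝ)
    (h_moment : MaxEnt.MomentConstraint (MaxEnt.tiltedMass q T β) T t)
    (h_cov : IsUnit (MaxEnt.covMatrix (MaxEnt.tiltedMass q T β) T)) :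
    (∃ P' : MeasureTheory.Measure (ℕ → 𝒳), MeasureTheory.IsProbabilityMeasure P' ∧
      ∃ c : ℝ, 0 < c ∧ ∀ᶠ n : ℕ in Filter.atTop, ∀ x ∈ MaxEnt.constraintSet T t n,
        ((c * Real.logb 2 n : ℝ) : EReal) <
          MaxEnt.log2 (MaxEnt.seqMass P' x / MaxEnt.productMass (MaxEnt.tiltedMass q T β) x)) ∧
    (∃ P'' : MeasureTheory.Measure (ℕ → 𝒳), MeasureTheory.IsProbabilityMeasure P'' ∧
      ∃ c'' : ℝ, 0 < c'' ∧ ∀ n : ℕ, 1 ≤ n → ∀ x ∈ MaxEnt.constraintSet T t n,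
        (c'' : EReal) <
          MaxEnt.log2 (MaxEnt.seqMass P'' x / MaxEnt.productMass (MaxEnt.tiltedMass q T β) x)) := by
  obtain ⟨C, hC, hbound⟩ := MaxEnt.exists_measure_constraintEvent_le hk q T t β h_cov
  have hsum := MaxEnt.tsum_weighted_constraintEvent_ne_top hbound
  refine ⟨MaxEnt.exists_logarithmic_gain q T t β hsum, MaxEnt.exists_constant_gain q T t β ?_⟩
  -- The weights are at least 1 from index 1 on, so the weighted sum dominates the unweighted one.
  refine ne_top_of_le_ne_top hsum (le_trans (ENNReal.tsum_le_tsum fun n => ?_)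
    (ENNReal.tsum_comp_le_tsum_of_injective (add_left_injective 1) _))
  refine le_mul_of_one_le_left zero_le (ENNReal.one_le_ofReal.2 ?_)
  exact Real.one_le_rpow (by simp) (by norm_num)
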